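/- For positive reals $r_1,r_2,r_3$ let $P(r_1,r_2,r_3)\subset\mathbb{R}^6$ be the open polydisk $B^2(r_1)\times B^2(r_2)\times B^2(r_3)$, i.e. the set of points $(x_1,y_1,x_2,y_2,x_3,y_3)$ with $x_i^2+y_i^2<r_i^2$ for $i=1,2,3$, and equip $\mathbb{R}^6$ with the standard symplectic form $\omega=\sum_{i=1}^3 dx_i\wedge dy_i$. There exists a constant $C>0$ such that for all real numbers $0<R_1\le R_2\le R_3$ and all real $\lambda$ with $1\le\lambda\le R_2/R_1$, the polydisk $P(R_1,R_2,R_3)$ symplectically embeds into $P(CR_1,\,CR_2/\lambda,\,C\lambda R_3)$; that is, there is a smooth embedding $f:P(R_1,R_2,R_3)\to\mathbb{R}^6$ with image contained in $P(CR_1,\,CR_2/\lambda,\,C\lambda R_3)$ and $f^*\omega=\omega$. -/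

import Mathlib

open scoped ContDiff

/-- The phase space `ℝ^{2n}`: the `i`-th entry of a point is its pair of coordinates `(x_i, y_i)`. -/
abbrev PhaseSpace (n : ℕ) : Type := Fin n → ℝ × ℝ

/-- The standard symplectic form `ω = ∑ dx_i ∧ dy_i`, evaluated on two tangent vectors. -/
def stdSymplecticForm {n : ℕ} (v w : PhaseSpace n) : ℝ :=
  ∑ i, ((v i).1 * (w i).2 - (v i).2 * (w i).1)

/-- The open polydisk `B²(R_1) × ⋯ × B²(R_n)`, given by `x_i² + y_i² < R_i²` for every `i`. -/
def polydisk {n : ℕ} (R : Fin n → ℝ) : Set (PhaseSpace n) :=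
  {p | ∀ i, (p i).1 ^ 2 + (p i).2 ^ 2 < R i ^ 2}

/-- `f` restricts to a symplectic embedding of the open set `U` into `V`: on `U` it is smooth,
a homeomorphism onto its image, and pulls the standard symplectic form back to itself
(so that its differential is injective at every point of `U`), and it maps `U` into `V`.
The values of `f` outside `U` play no role. -/
structure IsSymplecticEmbeddingOn {n : ℕ} (f : PhaseSpace n → PhaseSpace n)
    (U V : Set (PhaseSpace n)) : Prop where
  contDiffOn : ContDiffOn ℝ ∞ f U
  isEmbedding : Topology.IsEmbedding (U.domRestrict f)
  pullback_eq : ∀ z ∈ U, ∀ v w : PhaseSpace n,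
    stdSymplecticForm (fderiv ℝ f z v) (fderiv ℝ f z w) = stdSymplecticForm v w
  mapsTo : Set.MapsTo f U V

/-- The open set `U` symplectically embeds into `V`. -/
def SymplecticallyEmbeds {n : ℕ} (U V : Set (PhaseSpace n)) : Prop :=
  ∃ f : PhaseSpace n → PhaseSpace n, IsSymplecticEmbeddingOn f U V

/-! The second factor is squeezed by immersing a long strip in a disk of bounded size, and the
double points of the immersion are undone in the other two factors.

After rescaling, `shear` adds y₃ to y₂, so that the second factor becomes a strip along a whole
line, and replaces x₃ by x₃ - x₂. Since y₃ and x₃ - x₂ are visible in the image, y₂ + y₃ and x₂ are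
already known up to small errors and need only be recovered modulo fixed periods. `respeed` makes
the strip of bounded width except near the multiples of 2π, where it keeps long arms. `ribbon` wraps
it around a closed convex curve and `polar` winds the arms around an annulus whose size does not
depend on their length. The image is an immersed punctured torus: apart from the two periods, its
only double points are crossings of an arm with the band around the curve. `lift` separates these
two sheets by moving x₁ by its own width ε along the band.

`polar_ribbon_injective` classifies the double points and `injOn_foldMap` resolves them. Each stage
preserves the symplectic form, and injectivity then suffices by `isSymplecticEmbeddingOn_of_injOn`.
-/

/-! ### Maps that rescale the symplectic form -/

/-- The area form of the plane. -/
def planeForm (u v : ℝ × ℝ) : ℝ := u.1 * v.2 - u.2 * v.1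

/-- `φ` is smooth at `p` and multiplies the area form by `c` there. -/
structure ScalesAreaAt (c : ℝ) (φ : ℝ × ℝ → ℝ × ℝ) (p : ℝ × ℝ) : Prop where
  contDiffAt : ContDiffAt ℝ ∞ φ p
  form_eq : ∀ u v, planeForm (fderiv ℝ φ p u) (fderiv ℝ φ p v) = c * planeForm u v

/-- `f` is smooth at `z` and multiplies the standard symplectic form by `c` there. -/
structure ScalesFormAt {n : ℕ} (c : ℝ) (f : PhaseSpace n → PhaseSpace n) (z : PhaseSpace n) :
    Prop where
  contDiffAt : ContDiffAt ℝ ∞ f z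
  form_eq : ∀ u v, stdSymplecticForm (fderiv ℝ f z u) (fderiv ℝ f z v) =
    c * stdSymplecticForm u v

theorem ScalesAreaAt.comp {c d : ℝ} {φ ψ : ℝ × ℝ → ℝ × ℝ} {p : ℝ × ℝ}
    (hψ : ScalesAreaAt d ψ (φ p)) (hφ : ScalesAreaAt c φ p) :
    ScalesAreaAt (d * c) (ψ ∘ φ) p := by
  refine ⟨hψ.contDiffAt.comp p hφ.contDiffAt, fun u v => ?_⟩
  rw [fderiv_comp p (hψ.contDiffAt.differentiableAt (by simp))
    (hφ.contDiffAt.differentiableAt (by simp))]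
  simp only [ContinuousLinearMap.comp_apply, hψ.form_eq, hφ.form_eq, mul_assoc]

theorem ScalesFormAt.comp {n : ℕ} {c d : ℝ} {f g : PhaseSpace n → PhaseSpace n}
    {z : PhaseSpace n} (hg : ScalesFormAt d g (f z)) (hf : ScalesFormAt c f z) :
    ScalesFormAt (d * c) (g ∘ f) z := by
  refine ⟨hg.contDiffAt.comp z hf.contDiffAt, fun u v => ?_⟩
  rw [fderiv_comp z (hg.contDiffAt.differentiableAt (by simp))
    (hf.contDiffAt.differentiableAt (by simp))]
  simp only [ContinuousLinearMap.comp_apply, hg.form_eq, hf.form_eq, mul_assoc]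

/-- A product of maps of the plane which all multiply the area form by `c` multiplies the
symplectic form by `c`. -/
theorem scalesFormAt_prod {n : ℕ} {c : ℝ} {φ : Fin n → ℝ × ℝ → ℝ × ℝ} {z : PhaseSpace n}
    (h : ∀ i, ScalesAreaAt c (φ i) (z i)) : ScalesFormAt c (fun p i => φ i (p i)) z := by
  have hd : HasFDerivAt (fun (p : PhaseSpace n) i => φ i (p i))
      (ContinuousLinearMap.pi fun i =>
        (fderiv ℝ (φ i) (z i)).comp (ContinuousLinearMap.proj i)) z := by
    refine hasFDerivAt_pi.2 fun i => ?_
    exact (((h i).contDiffAt.differentiableAt (by simp)).hasFDerivAt).comp z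
      (hasFDerivAt_apply i z)
  refine ⟨contDiffAt_pi.2 fun i => (h i).contDiffAt.comp z (contDiff_apply ℝ (ℝ × ℝ) i).contDiffAt,
    fun u v => ?_⟩
  rw [hd.fderiv]
  simp only [stdSymplecticForm, Finset.mul_sum]
  exact Finset.sum_congr rfl fun i _ => (h i).form_eq (u i) (v i)

theorem scalesAreaAt_id (p : ℝ × ℝ) : ScalesAreaAt 1 id p :=
  ⟨contDiffAt_id, fun u v => by simp⟩

/-- The map `(x, y) ↦ (a (x + r), b (y + r))` multiplies area by `a b`. -/
theorem scalesAreaAt_affine (a b r : ℝ) (p : ℝ × ℝ) :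
    ScalesAreaAt (a * b) (fun q => (a * (q.1 + r), b * (q.2 + r))) p := by
  have h1 : HasFDerivAt (fun q : ℝ × ℝ => a * (q.1 + r)) (a • ContinuousLinearMap.fst ℝ ℝ ℝ) p :=
    (hasFDerivAt_fst.add_const r).const_mul a
  have h2 : HasFDerivAt (fun q : ℝ × ℝ => b * (q.2 + r)) (b • ContinuousLinearMap.snd ℝ ℝ ℝ) p :=
    (hasFDerivAt_snd.add_const r).const_mul b
  refine ⟨by fun_prop, fun u v => ?_⟩
  rw [(h1.prodMk h2).fderiv]
  simp [planeForm]
  ring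

/-- An injective smooth map which preserves the symplectic form on an open set is a symplectic
embedding. -/
theorem isSymplecticEmbeddingOn_of_injOn {n : ℕ} {f : PhaseSpace n → PhaseSpace n}
    {U V : Set (PhaseSpace n)} (hU : IsOpen U) (hf : ∀ z ∈ U, ScalesFormAt 1 f z)
    (hinj : Set.InjOn f U) (hmaps : Set.MapsTo f U V) : IsSymplecticEmbeddingOn f U V := by
  have hc : ContDiffOn ℝ ∞ f U := fun z hz => (hf z hz).contDiffAt.contDiffWithinAt
  refine ⟨hc, ?_, fun z hz v w => by rw [(hf z hz).form_eq, one_mul], hmaps⟩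
  -- Nondegeneracy makes the derivative injective, hence bijective by dimension, so `f` is open at
  -- each point of `U`.
  have hker : ∀ z ∈ U, Function.Injective (fderiv ℝ f z) := by
    intro z hz
    refine (injective_iff_map_eq_zero _).2 fun v hv => ?_
    have key : ∀ w, stdSymplecticForm v w = 0 := fun w => by
      have := (hf z hz).form_eq v w
      rw [hv, one_mul] at this
      rw [← this]
      simp [stdSymplecticForm]
    funext i
    have h1 := key (Pi.single i (0, 1))
    have h2 := key (Pi.single i (1, 0))
    have e1 : ∀ q : ℝ × ℝ, stdSymplecticForm v (Pi.single i q) =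
        (v i).1 * q.2 - (v i).2 * q.1 := by
      intro q
      rw [stdSymplecticForm, Finset.sum_eq_single i]
      · simp
      · intro j _ hj
        simp [Pi.single_eq_of_ne hj]
      · simp
    rw [e1] at h1 h2
    ext <;> simp_all
  have hopen : ∀ z ∈ U, Filter.map f (nhds z) = nhds (f z) := by
    intro z hz
    have hs : HasStrictFDerivAt f (fderiv ℝ f z) z :=
      ((hf z hz).contDiffAt.hasStrictFDerivAt (by simp))
    refine hs.map_nhds_eq_of_surj ?_
    rw [LinearMap.range_eq_top]
    exact LinearMap.injective_iff_surjective.1 (hker z hz)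
  have hcont : Continuous (U.domRestrict f) := continuousOn_iff_continuous_domRestrict.1 hc.continuousOn
  refine Topology.IsOpenEmbedding.isEmbedding
    (Topology.IsOpenEmbedding.of_continuous_injective_isOpenMap hcont ?_ ?_)
  · exact Set.injOn_iff_injective.1 hinj
  · refine IsOpenMap.of_nhds_le fun z => ?_
    have : Filter.map (U.domRestrict f) (nhds z) = nhds (f z) := by
      have e : U.domRestrict f = f ∘ Subtype.val := rfl
      rw [e, ← Filter.map_map, map_nhds_subtype_coe_eq_nhds z.2 (hU.mem_nhds z.2), hopen z z.2]
    exact this.ge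

/-! ### Primitives of functions on the line -/

open Real intervalIntegral MeasureTheory

/-- The primitive of `f` which vanishes at `0`. -/
noncomputable def primitive (f : ℝ → ℝ) (t : ℝ) : ℝ := ∫ u in (0 : ℝ)..t, f u

theorem hasDerivAt_primitive {f : ℝ → ℝ} (hf : Continuous f) (t : ℝ) :
    HasDerivAt (primitive f) (f t) t :=
  integral_hasDerivAt_right (hf.intervalIntegrable 0 t) hf.aestronglyMeasurable.stronglyMeasurableAtFilter
    hf.continuousAt

theorem contDiff_primitive {f : ℝ → ℝ} (hf : ContDiff ℝ ∞ f) : ContDiff ℝ ∞ (primitive f) := by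
  refine contDiff_infty_iff_deriv.2 ⟨fun t => (hasDerivAt_primitive hf.continuous t).differentiableAt, ?_⟩
  rwa [funext fun t => (hasDerivAt_primitive hf.continuous t).deriv]

theorem primitive_sub {f : ℝ → ℝ} (hf : Continuous f) (s t : ℝ) :
    primitive f t - primitive f s = ∫ u in s..t, f u :=
  integral_interval_sub_left (hf.intervalIntegrable 0 t) (hf.intervalIntegrable 0 s)

@[simp] theorem primitive_zero (f : ℝ → ℝ) : primitive f 0 = 0 := by simp [primitive]

theorem primitive_add_int_mul {f : ℝ → ℝ} {T : ℝ} (hf : Continuous f) (hp : Function.Periodic f T)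
    (n : ℤ) (t : ℝ) : primitive f (t + n * T) = primitive f t + n * primitive f T := by
  have h := hp.intervalIntegral_add_zsmul_eq n t (fun a b => hf.intervalIntegrable a b)
  rw [← hp.intervalIntegral_add_eq 0 t, zsmul_eq_mul, zsmul_eq_mul, ← primitive_sub hf, zero_add] at h
  rw [← primitive] at h
  linarith

theorem primitive_mono {f : ℝ → ℝ} (hf : Continuous f) (h0 : ∀ t, 0 ≤ f t) :
    Monotone (primitive f) := fun s t hst => by
  have := integral_nonneg hst (μ := volume) (f := f) (fun u _ => h0 u)
  rw [← primitive_sub hf] at this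
  linarith

theorem abs_primitive_le {f : ℝ → ℝ} (h1 : ∀ t, |f t| ≤ 1) (t : ℝ) : |primitive f t| ≤ |t| := by
  have := norm_integral_le_of_norm_le_const (a := (0 : ℝ)) (b := t) (f := f) (C := 1)
    (fun u _ => h1 u)
  simpa [primitive] using this

/-! ### Periodic cut-off functions -/

/-- A cut-off supported where `19 / 20 < cos t`. -/
noncomputable def bulkBump (t : ℝ) : ℝ := smoothTransition (40 * cos t - 38)

/-- The profile of the lift: `0` where `19 / 20 ≤ cos t` and `1` where `cos t ≤ 9 / 10`. -/
noncomputable def liftProfile (t : ℝ) : ℝ := smoothTransition (19 - 20 * cos t)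

theorem contDiff_bulkBump : ContDiff ℝ ∞ bulkBump :=
  (smoothTransition.contDiff (n := ⊤)).comp (by fun_prop : ContDiff ℝ ∞ fun t => 40 * cos t - 38)

theorem contDiff_liftProfile : ContDiff ℝ ∞ liftProfile :=
  (smoothTransition.contDiff (n := ⊤)).comp (by fun_prop : ContDiff ℝ ∞ fun t => 19 - 20 * cos t)

theorem bulkBump_nonneg (t : ℝ) : 0 ≤ bulkBump t := smoothTransition.nonneg _

theorem bulkBump_le_one (t : ℝ) : bulkBump t ≤ 1 := smoothTransition.le_one _

theorem bulkBump_eq_zero {t : ℝ} (h : cos t ≤ 19 / 20) : bulkBump t = 0 :=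
  smoothTransition.zero_of_nonpos (by linarith)

theorem bulkBump_periodic : Function.Periodic bulkBump (2 * π) := fun t => by
  simp [bulkBump]

theorem liftProfile_periodic : Function.Periodic liftProfile (2 * π) := fun t => by
  simp [liftProfile]

theorem liftProfile_nonneg (t : ℝ) : 0 ≤ liftProfile t := smoothTransition.nonneg _

theorem liftProfile_le_one (t : ℝ) : liftProfile t ≤ 1 := smoothTransition.le_one _

theorem liftProfile_eq_zero {t : ℝ} (h : 19 / 20 ≤ cos t) : liftProfile t = 0 :=
  smoothTransition.zero_of_nonpos (by linarith)

theorem liftProfile_eq_one {t : ℝ} (h : cos t ≤ 9 / 10) : liftProfile t = 1 :=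
  smoothTransition.one_of_one_le (by linarith)

theorem exists_abs_sub_int_mul_le (t : ℝ) : ∃ n : ℤ, |t - n * (2 * π)| ≤ π := by
  refine ⟨round (t / (2 * π)), ?_⟩
  have h := abs_sub_round (t / (2 * π))
  have hp : 0 < 2 * π := by positivity
  have e : t - round (t / (2 * π)) * (2 * π) = (t / (2 * π) - round (t / (2 * π))) * (2 * π) := by
    field_simp
  rw [e, abs_mul, abs_of_pos hp]
  nlinarith

theorem exists_abs_deriv_liftProfile_le : ∃ M : ℝ, 1 ≤ M ∧ ∀ t, |deriv liftProfile t| ≤ M := by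
  have hc : Continuous (deriv liftProfile) := contDiff_liftProfile.continuous_deriv (by simp)
  obtain ⟨M, hM⟩ := (isCompact_Icc (a := -π) (b := π)).exists_bound_of_continuousOn hc.continuousOn
  refine ⟨max 1 M, le_max_left _ _, fun t => ?_⟩
  obtain ⟨n, hn⟩ := exists_abs_sub_int_mul_le t
  have hp : deriv liftProfile (t - n * (2 * π)) = deriv liftProfile t := by
    rw [← deriv_comp_sub_const]
    congr 1
    exact funext fun u => liftProfile_periodic.sub_int_mul_eq n
  rw [← hp]
  exact (hM _ (abs_le.1 hn)).trans (le_max_right _ _)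

/-! ### The change of speed -/

/-- A diffeomorphism of the line with derivative `η + bulkBump`. -/
noncomputable def clock (η t : ℝ) : ℝ := η * t + primitive bulkBump t

theorem hasDerivAt_clock (η t : ℝ) : HasDerivAt (clock η) (η + bulkBump t) t := by
  have := ((hasDerivAt_id' t).const_mul η).fun_add
    (hasDerivAt_primitive contDiff_bulkBump.continuous t)
  rw [mul_one] at this
  exact this

theorem contDiff_clock (η : ℝ) : ContDiff ℝ ∞ (clock η) :=
  (contDiff_const.mul contDiff_id).add (contDiff_primitive contDiff_bulkBump)

theorem clock_strictMono {η : ℝ} (hη : 0 < η) : StrictMono (clock η) := fun _ _ h =>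
  add_lt_add_of_lt_of_le (mul_lt_mul_of_pos_left h hη)
    (primitive_mono contDiff_bulkBump.continuous bulkBump_nonneg h.le)

theorem clock_surjective {η : ℝ} (hη : 0 < η) : Function.Surjective (clock η) := by
  have hm := primitive_mono contDiff_bulkBump.continuous bulkBump_nonneg
  refine (contDiff_clock η).continuous.surjective ?_ ?_
  · refine Filter.tendsto_atTop_mono' _ ?_ (Filter.tendsto_id.const_mul_atTop hη)
    filter_upwards [Filter.eventually_ge_atTop 0] with t ht
    have := hm ht
    simp only [primitive_zero] at this
    simp only [clock, id]
    linarith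
  · refine Filter.tendsto_atBot_mono' _ ?_ (Filter.tendsto_id.const_mul_atBot hη)
    filter_upwards [Filter.eventually_le_atBot 0] with t ht
    have := hm ht
    simp only [primitive_zero] at this
    simp only [clock, id]
    linarith

/-- The clock as a homeomorphism of the line. -/
noncomputable def clockHomeo {η : ℝ} (hη : 0 < η) : ℝ ≃ₜ ℝ :=
  ((clock_strictMono hη).orderIsoOfSurjective _ (clock_surjective hη)).toHomeomorph

@[simp] theorem clockHomeo_apply {η : ℝ} (hη : 0 < η) (t : ℝ) : clockHomeo hη t = clock η t := rfl

theorem clock_symm_apply {η : ℝ} (hη : 0 < η) (y : ℝ) : clock η ((clockHomeo hη).symm y) = y :=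
  (clockHomeo hη).apply_symm_apply y

theorem contDiff_clock_symm {η : ℝ} (hη : 0 < η) : ContDiff ℝ ∞ (clockHomeo hη).symm :=
  (clockHomeo hη).contDiff_symm_deriv (f' := fun t => η + bulkBump t)
    (fun t => (add_pos_of_pos_of_nonneg hη (bulkBump_nonneg t)).ne')
    (fun t => hasDerivAt_clock η t) (contDiff_clock η)

theorem hasDerivAt_clock_symm {η : ℝ} (hη : 0 < η) (y : ℝ) :
    HasDerivAt (clockHomeo hη).symm (η + bulkBump ((clockHomeo hη).symm y))⁻¹ y :=
  HasDerivAt.of_local_left_inverse (clockHomeo hη).symm.continuous.continuousAt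
    (hasDerivAt_clock η _) (add_pos_of_pos_of_nonneg hη (bulkBump_nonneg _)).ne'
    (Filter.Eventually.of_forall (clock_symm_apply hη))

theorem clock_add_int_mul (η : ℝ) (n : ℤ) (t : ℝ) :
    clock η (t + n * (2 * π)) = clock η t + n * clock η (2 * π) := by
  simp only [clock, primitive_add_int_mul contDiff_bulkBump.continuous bulkBump_periodic]
  ring

/-- The bump equals 1 on [-1/8, 1/8]. The bound matches the range of y₂ in `InBox`, so that distinct
periods of the clock cannot be confused. -/
theorem clock_period_gt {η : ℝ} (hη : 0 < η) : 1 / 4 ≤ clock η (2 * π) := by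
  have hper := primitive_add_int_mul contDiff_bulkBump.continuous bulkBump_periodic 1 (-(1 / 8))
  have hm := primitive_mono contDiff_bulkBump.continuous bulkBump_nonneg
    (show (1 / 8 : ℝ) ≤ -(1 / 8) + (1 : ℤ) * (2 * π) by push_cast; linarith [pi_gt_three])
  have hone : ∫ u in (-(1 / 8 : ℝ))..(1 / 8), bulkBump u = ∫ _ in (-(1 / 8 : ℝ))..(1 / 8), (1 : ℝ) := by
    refine integral_congr fun u hu => ?_
    rw [Set.uIcc_of_le (by norm_num)] at hu
    have := one_sub_sq_div_two_le_cos (x := u)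
    refine smoothTransition.one_of_one_le ?_
    nlinarith [hu.1, hu.2]
  rw [← primitive_sub contDiff_bulkBump.continuous] at hone
  norm_num at hone
  push_cast at hper
  have : 0 < η * (2 * π) := by positivity
  simp only [clock]
  linarith

theorem eq_of_abs_clock_sub_lt {η s t : ℝ} (hη : 0 < η) {n : ℤ} (h : s = t + n * (2 * π))
    (hd : |clock η s - clock η t| < 1 / 4) : s = t := by
  have hq := clock_period_gt hη
  rw [h, clock_add_int_mul, add_sub_cancel_left, abs_mul, abs_of_nonneg (by linarith : 0 ≤ clock η (2 * π))] at hd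
  have hn : |(n : ℝ)| < 1 := by
    by_contra hc
    nlinarith
  have : n = 0 := by
    rw [← Int.cast_abs] at hn
    exact Int.abs_lt_one_iff.1 (by exact_mod_cast hn)
  simp [h, this]

/-- `(x, y) ↦ (1 + x h'(t), t)`, where `h` is the clock and `t = h⁻¹(y)`. -/
noncomputable def respeed {η : ℝ} (hη : 0 < η) (p : ℝ × ℝ) : ℝ × ℝ :=
  (1 + p.1 * (η + bulkBump ((clockHomeo hη).symm p.2)), (clockHomeo hη).symm p.2)

/-- The first coordinate is stretched by h'(t) while dt = dy / h'(t). The added 1 leaves room for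
the later displacement by `lift`, since `ribbon` needs a positive first coordinate. -/
theorem scalesAreaAt_respeed {η : ℝ} (hη : 0 < η) (p : ℝ × ℝ) :
    ScalesAreaAt 1 (respeed hη) p := by
  have hs := contDiff_clock_symm hη
  have hb := contDiff_bulkBump
  set τ := (clockHomeo hη).symm with hτ
  have hpos : 0 < η + bulkBump (τ p.2) := add_pos_of_pos_of_nonneg hη (bulkBump_nonneg _)
  have h2 : HasFDerivAt (fun q : ℝ × ℝ => τ q.2)
      ((η + bulkBump (τ p.2))⁻¹ • ContinuousLinearMap.snd ℝ ℝ ℝ) p :=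
    (hasDerivAt_clock_symm hη p.2).comp_hasFDerivAt p hasFDerivAt_snd
  have hbd : HasDerivAt bulkBump (deriv bulkBump (τ p.2)) (τ p.2) :=
    (hb.differentiable (by simp) _).hasDerivAt
  have h1 := (hasFDerivAt_fst (𝕜 := ℝ) (p := p)).mul ((hbd.comp_hasFDerivAt p h2).const_add η)
  have h3 := ((h1.const_add 1).prodMk h2)
  refine ⟨?_, fun u v => ?_⟩
  · refine ContDiffAt.prodMk ?_ ?_
    · exact contDiffAt_const.add (contDiffAt_fst.mul (contDiffAt_const.add
        ((hb.comp (hs.comp contDiff_snd)).contDiffAt)))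
    · exact (hs.comp contDiff_snd).contDiffAt
  · have e : fderiv ℝ (respeed hη) p = _ := h3.fderiv
    rw [e]
    simp [planeForm]
    field_simp
    ring

/-! ### A closed convex curve with straight sides -/

/-- A cut-off which vanishes where `1 / 2 ≤ cos (2 t)`. -/
noncomputable def turnBump (t : ℝ) : ℝ := smoothTransition (1 - 2 * cos (2 * t))

theorem contDiff_turnBump : ContDiff ℝ ∞ turnBump :=
  (smoothTransition.contDiff (n := ⊤)).comp
    (by fun_prop : ContDiff ℝ ∞ fun t => 1 - 2 * cos (2 * t))

theorem turnBump_nonneg (t : ℝ) : 0 ≤ turnBump t := smoothTransition.nonneg _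

theorem turnBump_periodic : Function.Periodic turnBump π := fun t => by
  simp [turnBump, mul_add]

theorem primitive_turnBump_pos : 0 < primitive turnBump π := by
  refine intervalIntegral.integral_pos pi_pos contDiff_turnBump.continuous.continuousOn
    (fun t _ => turnBump_nonneg t) ⟨π / 2, ⟨by positivity, by linarith [pi_pos]⟩, ?_⟩
  refine smoothTransition.pos_of_pos ?_
  rw [mul_div_cancel₀ _ two_ne_zero, cos_pi]
  norm_num

/-- The curvature of the curve. -/
noncomputable def curvature (t : ℝ) : ℝ := π / primitive turnBump π * turnBump t

theorem contDiff_curvature : ContDiff ℝ ∞ curvature := contDiff_const.mul contDiff_turnBump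

theorem curvature_nonneg (t : ℝ) : 0 ≤ curvature t :=
  mul_nonneg (div_nonneg pi_pos.le primitive_turnBump_pos.le) (turnBump_nonneg t)

theorem curvature_periodic : Function.Periodic curvature π := fun t => by
  simp [curvature, turnBump_periodic t]

/-- Here cos 2t ≥ 2 (9/10)² - 1 > 1/2. The straight side thus contains the arms, where cos t >
19/20, with a margin in which `liftProfile` can rise from 0 to 1. -/
theorem curvature_eq_zero {t : ℝ} (h : 9 / 10 ≤ cos t) : curvature t = 0 := by
  rw [curvature, turnBump, smoothTransition.zero_of_nonpos, mul_zero]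
  rw [cos_two_mul]
  nlinarith

/-- The direction of the outward normal of the curve. -/
noncomputable def heading : ℝ → ℝ := primitive curvature

theorem contDiff_heading : ContDiff ℝ ∞ heading := contDiff_primitive contDiff_curvature

theorem hasDerivAt_heading (t : ℝ) : HasDerivAt heading (curvature t) t :=
  hasDerivAt_primitive contDiff_curvature.continuous t

theorem heading_mono : Monotone heading :=
  primitive_mono contDiff_curvature.continuous curvature_nonneg

theorem heading_pi : heading π = π := by
  have h := primitive_turnBump_pos.ne'
  rw [heading, primitive]
  simp only [curvature, intervalIntegral.integral_const_mul]
  exact div_mul_cancel₀ _ h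

theorem heading_add_int_mul_pi (n : ℤ) (t : ℝ) : heading (t + n * π) = heading t + n * π := by
  rw [heading, primitive_add_int_mul contDiff_curvature.continuous curvature_periodic]
  rw [show primitive curvature π = π from heading_pi]

theorem heading_add_pi (t : ℝ) : heading (t + π) = heading t + π := by
  simpa using heading_add_int_mul_pi 1 t

theorem heading_add_int_mul (n : ℤ) (t : ℝ) :
    heading (t + n * (2 * π)) = heading t + n * (2 * π) := by
  have := heading_add_int_mul_pi (n * 2) t
  push_cast at this
  rw [← mul_assoc, this]

/-- The abscissa of the curve. -/
noncomputable def curveX : ℝ → ℝ := primitive fun t => -sin (heading t)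

/-- The ordinate of the curve. -/
noncomputable def curveY : ℝ → ℝ := primitive fun t => cos (heading t)

theorem contDiff_sin_heading : ContDiff ℝ ∞ fun t => -sin (heading t) :=
  (contDiff_sin.comp contDiff_heading).neg

theorem contDiff_cos_heading : ContDiff ℝ ∞ fun t => cos (heading t) :=
  contDiff_cos.comp contDiff_heading

theorem hasDerivAt_curveX (t : ℝ) : HasDerivAt curveX (-sin (heading t)) t :=
  hasDerivAt_primitive contDiff_sin_heading.continuous t

theorem hasDerivAt_curveY (t : ℝ) : HasDerivAt curveY (cos (heading t)) t :=
  hasDerivAt_primitive contDiff_cos_heading.continuous t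

/-- The two half periods cancel. This closes the curve: its curvature has period π and total π over
a period, so its tangent is antiperiodic. -/
theorem primitive_periodic_of_antiperiodic {f : ℝ → ℝ} (hf : Continuous f)
    (h : ∀ t, f (t + π) = -f t) (n : ℤ) (t : ℝ) :
    primitive f (t + n * (2 * π)) = primitive f t := by
  have hp : Function.Periodic f (2 * π) := fun t => by
    rw [two_mul, ← add_assoc, h, h, neg_neg]
  have h2 : primitive f (2 * π) - primitive f π = -primitive f π := by
    have := intervalIntegral.integral_comp_add_right (a := 0) (b := π) f π
    simp only [h, zero_add, intervalIntegral.integral_neg] at this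
    rw [primitive_sub hf, two_mul, ← this]
    rfl
  rw [primitive_add_int_mul hf hp, show primitive f (2 * π) = 0 by linarith]
  simp

theorem curveX_add_int_mul (n : ℤ) (t : ℝ) : curveX (t + n * (2 * π)) = curveX t :=
  primitive_periodic_of_antiperiodic contDiff_sin_heading.continuous
    (fun t => by rw [heading_add_pi, sin_add_pi]) n t

theorem curveY_add_int_mul (n : ℤ) (t : ℝ) : curveY (t + n * (2 * π)) = curveY t :=
  primitive_periodic_of_antiperiodic contDiff_cos_heading.continuous
    (fun t => by rw [heading_add_pi, cos_add_pi]) n t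

theorem abs_curveX_le (t : ℝ) : |curveX t| ≤ π := by
  obtain ⟨n, hn⟩ := exists_abs_sub_int_mul_le t
  rw [← sub_add_cancel t (n * (2 * π)), curveX_add_int_mul]
  exact (abs_primitive_le (fun u => by rw [abs_neg]; exact abs_sin_le_one _) _).trans hn

theorem abs_curveY_le (t : ℝ) : |curveY t| ≤ π := by
  obtain ⟨n, hn⟩ := exists_abs_sub_int_mul_le t
  rw [← sub_add_cancel t (n * (2 * π)), curveY_add_int_mul]
  exact (abs_primitive_le (fun u => abs_cos_le_one _) _).trans hn

/-- The displacement along a fixed direction. The inner normal at a point gives convexity, the mean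
heading of an arc gives injectivity. -/
theorem integral_cos_heading_sub (m s t : ℝ) :
    ∫ r in s..t, cos (heading r - m) =
      cos m * (curveY t - curveY s) - sin m * (curveX t - curveX s) := by
  have hs := contDiff_sin_heading.continuous
  have hc := contDiff_cos_heading.continuous
  rw [curveX, curveY, primitive_sub hs, primitive_sub hc, ← intervalIntegral.integral_const_mul,
    ← intervalIntegral.integral_const_mul, ← intervalIntegral.integral_sub
      ((hc.const_mul _).intervalIntegrable _ _) ((hs.const_mul _).intervalIntegrable _ _)]
  congr 1
  ext r
  rw [cos_sub]
  ring

/-- The curve lies on the inner side of each of its tangents. -/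
theorem curve_support (s t : ℝ) :
    (curveX t - curveX s) * cos (heading s) + (curveY t - curveY s) * sin (heading s) ≤ 0 := by
  obtain ⟨n, hn⟩ := exists_abs_sub_int_mul_le (t - s)
  have key : ∀ u, |u - s| ≤ π →
      (curveX u - curveX s) * cos (heading s) + (curveY u - curveY s) * sin (heading s) ≤ 0 := by
    intro u hu
    have hI := integral_cos_heading_sub (heading s + π / 2) s u
    rw [cos_add_pi_div_two, sin_add_pi_div_two] at hI
    have hsin : ∀ r, cos (heading r - (heading s + π / 2)) = sin (heading r - heading s) := fun r => by
      rw [← sub_sub, cos_sub_pi_div_two]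
    simp only [hsin] at hI
    suffices 0 ≤ ∫ r in s..u, sin (heading r - heading s) by linarith
    have h1 := heading_add_pi s
    have h2 := heading_add_pi (s - π)
    rw [sub_add_cancel] at h2
    rw [abs_le] at hu
    -- Over half of the curve the heading turns by at most π, so the sine keeps one sign.
    rcases le_total s u with h | h
    · refine integral_nonneg h fun r hr => sin_nonneg_of_nonneg_of_le_pi ?_ ?_
      · linarith [heading_mono hr.1]
      · linarith [heading_mono (show r ≤ s + π by linarith [hr.2])]
    · rw [integral_symm, ← intervalIntegral.integral_neg]
      refine integral_nonneg h fun r hr => neg_nonneg.2 (sin_nonpos_of_nonpos_of_neg_pi_le ?_ ?_)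
      · linarith [heading_mono hr.2]
      · linarith [heading_mono (show s - π ≤ r by linarith [hr.1])]
  have := key (t - n * (2 * π)) (by rwa [show t - n * (2 * π) - s = t - s - n * (2 * π) by ring])
  have e := sub_add_cancel t (n * (2 * π))
  rwa [← curveX_add_int_mul n (t - n * (2 * π)), ← curveY_add_int_mul n (t - n * (2 * π)), e] at this

/-- An arc of length at most half of the curve is not closed. -/
theorem curve_ne {s t : ℝ} (h : s < t) (ht : t ≤ s + π) (hX : curveX s = curveX t) :
    curveY s ≠ curveY t := by
  intro hY
  have hI := integral_cos_heading_sub ((heading s + heading t) / 2) s t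
  rw [hX, hY, sub_self, sub_self, mul_zero, mul_zero, sub_zero] at hI
  have hst := heading_mono h.le
  have hle : heading t ≤ heading s + π := by
    rw [← heading_add_pi]
    exact heading_mono ht
  -- The mean heading is attained, and the cosine is 1 there, so the integral is strictly positive.
  obtain ⟨r, hr, hr'⟩ := intermediate_value_Icc h.le contDiff_heading.continuous.continuousOn
    (show (heading s + heading t) / 2 ∈ Set.Icc _ _ from ⟨by linarith, by linarith⟩)
  refine hI.not_gt (intervalIntegral.integral_pos h ?_ ?_ ⟨r, hr, ?_⟩)
  · exact (continuous_cos.comp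
      (contDiff_heading.continuous.sub continuous_const)).continuousOn
  · intro q hq
    refine cos_nonneg_of_neg_pi_div_two_le_of_le ?_ ?_
    · linarith [heading_mono hq.1.le]
    · linarith [heading_mono hq.2]
  · simp [hr']

theorem curve_injective {s t : ℝ} (hX : curveX s = curveX t) (hY : curveY s = curveY t) :
    ∃ n : ℤ, s = t + n * (2 * π) := by
  obtain ⟨n, hn⟩ := exists_abs_sub_int_mul_le (s - t)
  refine ⟨n, ?_⟩
  rw [← sub_add_cancel s (n * (2 * π)), curveX_add_int_mul] at hX
  rw [← sub_add_cancel s (n * (2 * π)), curveY_add_int_mul] at hY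
  rw [abs_le] at hn
  rcases lt_trichotomy (s - n * (2 * π)) t with h | h | h
  · exact (curve_ne h (by linarith) hX hY).elim
  · linarith
  · exact (curve_ne h (by linarith) hX.symm hY.symm).elim

/-! ### The ribbon around the curve -/

/-- The distance `f` from a curve of curvature `k` which bounds the area `f + k f² / 2 = s`. -/
noncomputable def offset (k s : ℝ) : ℝ := 2 * s / (1 + √(1 + 2 * k * s))

theorem offset_nonneg {k s : ℝ} (hs : 0 ≤ s) : 0 ≤ offset k s := by
  unfold offset
  positivity

/-- `offset` is the nonnegative root of this quadratic, rationalised so that one formula also covers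
k = 0. -/
theorem offset_eq {k s : ℝ} (hk : 0 ≤ k) (hs : 0 ≤ s) :
    offset k s + k * offset k s ^ 2 / 2 = s := by
  have h := sq_sqrt (show 0 ≤ 1 + 2 * k * s by positivity)
  have h0 := sqrt_nonneg (1 + 2 * k * s)
  unfold offset
  set r := √(1 + 2 * k * s)
  have : 1 + r ≠ 0 := by positivity
  field_simp
  nlinarith

theorem offset_le {k s : ℝ} (hk : 0 ≤ k) (hs : 0 ≤ s) : offset k s ≤ s := by
  have := offset_eq hk hs
  have : 0 ≤ k * offset k s ^ 2 := by positivity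
  linarith

@[simp] theorem offset_zero (s : ℝ) : offset 0 s = s := by
  simp only [offset, mul_zero, zero_mul, add_zero, sqrt_one]
  ring

/-- The ribbon on the outer side of the curve, with area-preserving coordinates. -/
noncomputable def ribbon (p : ℝ × ℝ) : ℝ × ℝ :=
  (curveX p.2 + offset (curvature p.2) p.1 * cos (heading p.2),
    curveY p.2 + offset (curvature p.2) p.1 * sin (heading p.2))

theorem contDiffAt_offset {p : ℝ × ℝ} (hp : 0 < p.1) :
    ContDiffAt ℝ ∞ (fun q : ℝ × ℝ => offset (curvature q.2) q.1) p := by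
  have hk := curvature_nonneg p.2
  have hc : ContDiffAt ℝ ∞ (fun q : ℝ × ℝ => curvature q.2) p :=
    (contDiff_curvature.comp contDiff_snd).contDiffAt
  refine ContDiffAt.div (contDiffAt_const.mul contDiffAt_fst) (contDiffAt_const.add
    (ContDiffAt.sqrt (contDiffAt_const.add ((contDiffAt_const.mul hc).mul contDiffAt_fst)) ?_)) ?_
  · positivity
  · positivity

/-- With f the offset and k the curvature, the Jacobian is (1 + k f) ∂f/∂s, which is 1 by
differentiating the relation `offset_eq`. -/
theorem scalesAreaAt_ribbon {p : ℝ × ℝ} (hp : 0 < p.1) : ScalesAreaAt 1 ribbon p := by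
  have hsm := contDiffAt_offset hp
  have hcd : ContDiff ℝ ∞ curveX := contDiff_primitive contDiff_sin_heading
  have hcd' : ContDiff ℝ ∞ curveY := contDiff_primitive contDiff_cos_heading
  have hco : ContDiff ℝ ∞ fun t => sin (heading t) := contDiff_sin.comp contDiff_heading
  refine ⟨?_, fun u v => ?_⟩
  · refine ContDiffAt.prodMk ?_ ?_
    · exact (hcd.comp contDiff_snd).contDiffAt.add
        (hsm.mul (contDiff_cos_heading.comp contDiff_snd).contDiffAt)
    · exact (hcd'.comp contDiff_snd).contDiffAt.add
        (hsm.mul (hco.comp contDiff_snd).contDiffAt)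
  have hL := (hsm.differentiableAt (by simp)).hasFDerivAt
  set L := fderiv ℝ (fun q : ℝ × ℝ => offset (curvature q.2) q.1) p
  set f := offset (curvature p.2) p.1 with hf
  have hsnd : HasFDerivAt Prod.snd (ContinuousLinearMap.snd ℝ ℝ ℝ) p := hasFDerivAt_snd
  have hK := (contDiff_curvature.differentiable (by simp) p.2).hasDerivAt.comp_hasFDerivAt p hsnd
  have hH := (hasDerivAt_heading p.2).comp_hasFDerivAt p hsnd
  have hX := ((hasDerivAt_curveX p.2).comp_hasFDerivAt p hsnd).add (hL.mul hH.cos)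
  have hY := ((hasDerivAt_curveY p.2).comp_hasFDerivAt p hsnd).add (hL.mul hH.sin)
  have hid := hL.add ((hK.mul (hL.pow 2)).mul_const (1 / 2 : ℝ))
  have hev : (fun q : ℝ × ℝ => offset (curvature q.2) q.1 +
      curvature q.2 * offset (curvature q.2) q.1 ^ 2 * (1 / 2)) =ᶠ[nhds p] Prod.fst := by
    filter_upwards [continuous_fst.continuousAt.eventually (lt_mem_nhds hp)] with q hq
    have := offset_eq (curvature_nonneg q.2) (le_of_lt hq)
    linarith
  have huniq := HasFDerivAt.unique hid
    ((hasFDerivAt_fst (𝕜 := ℝ) (p := p)).congr_of_eventuallyEq hev)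
  have hrel : ∀ w : ℝ × ℝ, (1 + curvature p.2 * f) * L w =
      w.1 - deriv curvature p.2 * f ^ 2 / 2 * w.2 := fun w => by
    have := congrArg (fun A : ℝ × ℝ →L[ℝ] ℝ => A w) huniq
    simp at this
    linarith
  have e : fderiv ℝ ribbon p = _ := (hX.prodMk hY).fderiv
  have hu := hrel u
  have hv := hrel v
  have hcs := sin_sq_add_cos_sq (heading p.2)
  rw [e]
  simp [planeForm, ← hf]
  set a := L u
  set b := L v
  set c := cos (heading p.2)
  set d := sin (heading p.2)
  linear_combination (hu * v.2 - hv * u.2) + ((1 + curvature p.2 * f) * (a * v.2 - b * u.2)) * hcs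

theorem ribbon_add_int_mul (n : ℤ) (s t : ℝ) :
    ribbon (s, t + n * (2 * π)) = ribbon (s, t) := by
  have hk : curvature (t + n * (2 * π)) = curvature t := by
    have := (curvature_periodic.int_mul (n * 2)) t
    push_cast at this
    rw [← this]
    ring_nf
  simp only [ribbon, curveX_add_int_mul, curveY_add_int_mul, heading_add_int_mul, hk,
    cos_add_int_mul_two_pi, sin_add_int_mul_two_pi]

/-- A point outside a convex curve has a single foot on it: for two feet, pairing their difference
with itself and applying `curve_support` at both bounds its squared length by 0. -/
theorem ribbon_injective {p q : ℝ × ℝ} (hp : 0 < p.1) (hq : 0 < q.1) (h : ribbon p = ribbon q) :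
    p.1 = q.1 ∧ ∃ n : ℤ, p.2 = q.2 + n * (2 * π) := by
  obtain ⟨s, t⟩ := p
  obtain ⟨s', t'⟩ := q
  simp only at hp hq ⊢
  have h1 := congrArg Prod.fst h
  have h2 := congrArg Prod.snd h
  simp only [ribbon] at h1 h2
  have hf := offset_nonneg (k := curvature t) hp.le
  have hf' := offset_nonneg (k := curvature t') hq.le
  have hsup := mul_nonpos_of_nonneg_of_nonpos hf (curve_support t t')
  have hsup' := mul_nonpos_of_nonneg_of_nonpos hf' (curve_support t' t)
  have hsum : (curveX t - curveX t') ^ 2 + (curveY t - curveY t') ^ 2 ≤ 0 := by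
    have e1 : curveX t - curveX t' = offset (curvature t') s' * cos (heading t') -
      offset (curvature t) s * cos (heading t) := by linarith
    have e2 : curveY t - curveY t' = offset (curvature t') s' * sin (heading t') -
      offset (curvature t) s * sin (heading t) := by linarith
    have e : (curveX t - curveX t') ^ 2 + (curveY t - curveY t') ^ 2 =
        (curveX t - curveX t') * (curveX t - curveX t') +
          (curveY t - curveY t') * (curveY t - curveY t') := by ring
    rw [e]
    nth_rewrite 2 [e1]
    nth_rewrite 2 [e2]
    linarith
  have hX : curveX t = curveX t' := by nlinarith [sq_nonneg (curveX t - curveX t'), sq_nonneg (curveY t - curveY t')]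
  have hY : curveY t = curveY t' := by nlinarith [sq_nonneg (curveX t - curveX t'), sq_nonneg (curveY t - curveY t')]
  obtain ⟨n, rfl⟩ := curve_injective hX hY
  refine ⟨?_, n, rfl⟩
  rw [ribbon_add_int_mul] at h
  have h1 := congrArg Prod.fst h
  have h2 := congrArg Prod.snd h
  simp only [ribbon, add_right_inj] at h1 h2
  have hk := curvature_nonneg t'
  have hoff : offset (curvature t') s = offset (curvature t') s' := by
    have hcs := sin_sq_add_cos_sq (heading t')
    linear_combination (offset (curvature t') s' - offset (curvature t') s) * hcs +
      cos (heading t') * h1 + sin (heading t') * h2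
  rw [← offset_eq hk hp.le, hoff, offset_eq hk hq.le]

/-- Arms are straight and horizontal, so their ordinates stay bounded however long they are. -/
theorem ribbon_of_cos_ge {t : ℝ} (ht : 9 / 10 ≤ cos t) :
    ∃ n : ℤ, ∀ s, ribbon (s, t) = (s, t - n * (2 * π)) := by
  obtain ⟨n, hn⟩ := exists_abs_sub_int_mul_le t
  refine ⟨n, fun s => ?_⟩
  set r := t - n * (2 * π) with hr
  have hcr : 9 / 10 ≤ cos r := by rwa [hr, cos_sub_int_mul_two_pi]
  have hcu : ∀ u ∈ Set.uIcc 0 r, 9 / 10 ≤ cos u := by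
    intro u hu
    refine hcr.trans ?_
    rw [← cos_abs u, ← cos_abs r]
    refine cos_le_cos_of_nonneg_of_le_pi (abs_nonneg _) hn ?_
    simpa using Set.abs_sub_left_of_mem_uIcc hu
  have hhead : ∀ u ∈ Set.uIcc 0 r, heading u = 0 := by
    intro u hu
    rw [heading, primitive, intervalIntegral.integral_congr (g := fun _ => (0 : ℝ))]
    · simp
    · intro w hw
      exact curvature_eq_zero (hcu w (Set.uIcc_subset_uIcc_left hu hw))
  have hX : curveX r = 0 := by
    rw [curveX, primitive, intervalIntegral.integral_congr (g := fun _ => (0 : ℝ))]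
    · simp
    · intro w hw
      simp [hhead w hw]
  have hY : curveY r = r := by
    rw [curveY, primitive, intervalIntegral.integral_congr (g := fun _ => (1 : ℝ))]
    · simp
    · intro w hw
      simp [hhead w hw]
  rw [← sub_add_cancel t (n * (2 * π)), ← hr, ribbon_add_int_mul]
  simp [ribbon, hX, hY, hhead r Set.right_mem_uIcc, curvature_eq_zero hcr]

theorem abs_ribbon_fst_le {p : ℝ × ℝ} (hp : 0 ≤ p.1) : |(ribbon p).1| ≤ π + p.1 := by
  refine (abs_add_le _ _).trans (add_le_add (abs_curveX_le _) ?_)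
  rw [abs_mul, abs_of_nonneg (offset_nonneg hp)]
  exact (mul_le_of_le_one_right (offset_nonneg hp) (abs_cos_le_one _)).trans
    (offset_le (curvature_nonneg _) hp)

theorem abs_ribbon_snd_le {p : ℝ × ℝ} (hp : 0 ≤ p.1) : |(ribbon p).2| ≤ π + p.1 := by
  refine (abs_add_le _ _).trans (add_le_add (abs_curveY_le _) ?_)
  rw [abs_mul, abs_of_nonneg (offset_nonneg hp)]
  exact (mul_le_of_le_one_right (offset_nonneg hp) (abs_sin_le_one _)).trans
    (offset_le (curvature_nonneg _) hp)

/-! ### Winding around an annulus, and the double points -/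

/-- Symplectic polar coordinates, with angle `w.1 / 4` and area coordinate `w.2 + 10`. -/
noncomputable def polar (w : ℝ × ℝ) : ℝ × ℝ :=
  (√(8 * (w.2 + 10)) * sin (w.1 / 4), √(8 * (w.2 + 10)) * cos (w.1 / 4))

theorem polar_normSq {w : ℝ × ℝ} (hw : -10 < w.2) :
    (polar w).1 ^ 2 + (polar w).2 ^ 2 = 8 * (w.2 + 10) := by
  have h := sq_sqrt (show 0 ≤ 8 * (w.2 + 10) by linarith)
  have hcs := sin_sq_add_cos_sq (w.1 / 4)
  simp only [polar, mul_pow, h]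
  linear_combination (8 * (w.2 + 10)) * hcs

/-- Half the squared radius is 4 (w₂ + 10) and the angle is w₁ / 4, so the factors cancel. -/
theorem scalesAreaAt_polar {w : ℝ × ℝ} (hw : -10 < w.2) : ScalesAreaAt 1 polar w := by
  have hpos : 0 < 8 * (w.2 + 10) := by linarith
  have h1 : HasFDerivAt (fun q : ℝ × ℝ => q.1 / 4) ((1 / 4 : ℝ) • ContinuousLinearMap.fst ℝ ℝ ℝ) w := by
    refine ((hasFDerivAt_fst (𝕜 := ℝ) (p := w)).const_mul (1 / 4 : ℝ)).congr_of_eventuallyEq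
      (Filter.Eventually.of_forall fun q => ?_)
    simp only
    ring
  have h2 : HasFDerivAt (fun q : ℝ × ℝ => 8 * (q.2 + 10)) ((8 : ℝ) • ContinuousLinearMap.snd ℝ ℝ ℝ) w :=
    (hasFDerivAt_snd.add_const 10).const_mul 8
  have h3 := h2.sqrt hpos.ne'
  refine ⟨?_, fun u v => ?_⟩
  · have hs : ContDiffAt ℝ ∞ (fun q : ℝ × ℝ => √(8 * (q.2 + 10))) w :=
      ContDiffAt.sqrt (by fun_prop) hpos.ne'
    exact (hs.mul (by fun_prop)).prodMk (hs.mul (by fun_prop))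
  have e : fderiv ℝ polar w = _ := ((h3.mul h1.sin).prodMk (h3.mul h1.cos)).fderiv
  rw [e]
  have hr : √(8 * (w.2 + 10)) ≠ 0 := (sqrt_pos.2 hpos).ne'
  have hcs := sin_sq_add_cos_sq (w.1 / 4)
  generalize √(8 * (w.2 + 10)) = r at hr ⊢
  simp [planeForm]
  field_simp
  linear_combination 64 * r ^ 2 * (u.1 * v.2 - u.2 * v.1) * hcs

theorem polar_injective {w w' : ℝ × ℝ} (hw : -10 < w.2) (hw' : -10 < w'.2)
    (h : polar w = polar w') : w.2 = w'.2 ∧ ∃ m : ℤ, w.1 = w'.1 + m * (8 * π) := by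
  have h2 : w.2 = w'.2 := by
    have := polar_normSq hw
    rw [h, polar_normSq hw'] at this
    linarith
  refine ⟨h2, ?_⟩
  have hr : √(8 * (w'.2 + 10)) ≠ 0 := (sqrt_pos.2 (by linarith)).ne'
  have hs := congrArg Prod.fst h
  have hc := congrArg Prod.snd h
  simp only [polar, h2] at hs hc
  obtain ⟨m, hm⟩ := Real.Angle.angle_eq_iff_two_pi_dvd_sub.1
    (Real.Angle.cos_sin_inj (mul_left_cancel₀ hr hc) (mul_left_cancel₀ hr hs))
  exact ⟨m, by linarith⟩

/-- Two points of the immersed punctured torus with the same image either differ by a period or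
lie on different levels of the lift. -/
theorem polar_ribbon_injective {s t s' t' : ℝ} (hs : 1 / 2 ≤ s) (hs' : 1 / 2 ≤ s')
    (hb : cos t < 19 / 20 → s ≤ 5 / 2) (hb' : cos t' < 19 / 20 → s' ≤ 5 / 2)
    (h : polar (ribbon (s, t)) = polar (ribbon (s', t'))) :
    ((∃ n : ℤ, t = t' + n * (2 * π)) ∧ ∃ m : ℤ, s = s' + m * (8 * π)) ∨
      (liftProfile t = 0 ∧ liftProfile t' = 1) ∨ (liftProfile t = 1 ∧ liftProfile t' = 0) := by
  have hπ := pi_lt_d2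
  have hsnd : ∀ s t : ℝ, 1 / 2 ≤ s → (cos t < 19 / 20 → s ≤ 5 / 2) → -10 < (ribbon (s, t)).2 := by
    intro s t hs hb
    rcases lt_or_ge (cos t) (19 / 20) with hc | hc
    · have := abs_ribbon_snd_le (p := (s, t)) (by simpa using by linarith)
      have := (abs_le.1 this).1
      have := hb hc
      simp only at *
      linarith
    · obtain ⟨n, hn⟩ := ribbon_of_cos_ge (t := t) (by linarith)
      -- On an arm the ordinate does not depend on s, so it may be estimated at s = 1/2.
      have := abs_ribbon_snd_le (p := (1 / 2, t)) (by norm_num)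
      have := (abs_le.1 this).1
      rw [hn] at this ⊢
      simp only at *
      linarith
  have hfst : ∀ s t : ℝ, 1 / 2 ≤ s → s ≤ 5 / 2 → |(ribbon (s, t)).1| < 6 := by
    intro s t hs hs'
    have := abs_ribbon_fst_le (p := (s, t)) (by simpa using by linarith)
    simp only at this
    linarith
  have hbulk : ∀ {s t s' t' : ℝ} {m : ℤ}, 19 / 20 ≤ cos t → (ribbon (s, t)).2 = (ribbon (s', t')).2 →
      (ribbon (s, t)).1 = (ribbon (s', t')).1 + m * (8 * π) →
      ((∃ n : ℤ, t = t' + n * (2 * π)) ∧ s = s' + m * (8 * π)) ∨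
        (liftProfile t = 0 ∧ liftProfile t' = 1) := by
    intro s t s' t' m hc h2 h1
    rcases le_or_gt (9 / 10) (cos t') with hc' | hc'
    · obtain ⟨n, hn⟩ := ribbon_of_cos_ge (t := t) (by linarith)
      obtain ⟨n', hn'⟩ := ribbon_of_cos_ge hc'
      rw [hn, hn'] at h1 h2
      refine Or.inl ⟨⟨n - n', ?_⟩, h1⟩
      simp only at h2
      push_cast
      linarith
    · exact Or.inr ⟨liftProfile_eq_zero hc, liftProfile_eq_one hc'.le⟩
  obtain ⟨h2, m, h1⟩ := polar_injective (hsnd s t hs hb) (hsnd s' t' hs' hb') h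
  rcases le_or_gt (19 / 20) (cos t) with hc | hc
  · rcases hbulk hc h2 h1 with ⟨hn, hm⟩ | hl
    · exact Or.inl ⟨hn, m, hm⟩
    · exact Or.inr (Or.inl hl)
  rcases le_or_gt (19 / 20) (cos t') with hc' | hc'
  · have h1' : (ribbon (s', t')).1 = (ribbon (s, t)).1 + (-m : ℤ) * (8 * π) := by
      push_cast
      linarith
    rcases hbulk hc' h2.symm h1' with ⟨⟨n, hn⟩, hm⟩ | hl
    · refine Or.inl ⟨⟨-n, ?_⟩, m, ?_⟩
      · push_cast
        linarith
      · push_cast at hm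
        linarith
    · exact Or.inr (Or.inr hl.symm)
  -- Off the arms both abscissae are below 6 in absolute value, and 12 is less than the period 8π.
  · have hm : m = 0 := by
      have e : (m : ℝ) * (8 * π) = (ribbon (s, t)).1 - (ribbon (s', t')).1 := by linarith
      have hl := abs_sub (ribbon (s, t)).1 (ribbon (s', t')).1
      have hx := hfst s t hs (hb hc)
      have hx' := hfst s' t' hs' (hb' hc')
      rw [← e, abs_mul, abs_of_pos (by positivity : 0 < 8 * π)] at hl
      have hm1 : |(m : ℝ)| < 1 := by
        by_contra hcon
        nlinarith [pi_gt_three]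
      rw [← Int.cast_abs] at hm1
      exact Int.abs_lt_one_iff.1 (by exact_mod_cast hm1)
    subst hm
    have hr : ribbon (s, t) = ribbon (s', t') := Prod.ext (by simpa using h1) h2
    obtain ⟨e, hn⟩ := ribbon_injective (by simpa using by linarith) (by simpa using by linarith) hr
    exact Or.inl ⟨hn, 0, by simpa using e⟩

/-! ### The embedding of a product of rectangles -/

theorem scalesFormAt_vec {c : ℝ} {f₀ f₁ f₂ : PhaseSpace 3 → ℝ × ℝ} {z : PhaseSpace 3}
    {A₀ A₁ A₂ : PhaseSpace 3 →L[ℝ] ℝ × ℝ} (h₀ : ContDiff ℝ ∞ f₀) (h₁ : ContDiff ℝ ∞ f₁)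
    (h₂ : ContDiff ℝ ∞ f₂) (hA₀ : HasFDerivAt f₀ A₀ z) (hA₁ : HasFDerivAt f₁ A₁ z)
    (hA₂ : HasFDerivAt f₂ A₂ z)
    (h : ∀ u v, planeForm (A₀ u) (A₀ v) + planeForm (A₁ u) (A₁ v) + planeForm (A₂ u) (A₂ v) =
      c * stdSymplecticForm u v) :
    ScalesFormAt c (fun z => ![f₀ z, f₁ z, f₂ z]) z := by
  have hd : HasFDerivAt (fun z => ![f₀ z, f₁ z, f₂ z]) (ContinuousLinearMap.pi ![A₀, A₁, A₂]) z := by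
    refine hasFDerivAt_pi.2 fun i => ?_
    fin_cases i
    exacts [hA₀, hA₁, hA₂]
  refine ⟨contDiffAt_pi.2 fun i => ?_, fun u v => ?_⟩
  · fin_cases i
    exacts [h₀.contDiffAt, h₁.contDiffAt, h₂.contDiffAt]
  · rw [hd.fderiv, ← h, stdSymplecticForm, Fin.sum_univ_three]
    rfl

/-- The linear symplectic map `y₂ ↦ y₂ + y₃`, `x₃ ↦ x₃ - x₂`. -/
def shear (z : PhaseSpace 3) : PhaseSpace 3 :=
  ![z 0, ((z 1).1, (z 1).2 + (z 2).2), ((z 2).1 - (z 1).1, (z 2).2)]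

/-- Translation of `x₁` by a function of `y₂`. -/
noncomputable def lift (ε : ℝ) (z : PhaseSpace 3) : PhaseSpace 3 :=
  ![((z 0).1 + ε * liftProfile (z 1).2, (z 0).2),
    ((z 1).1 + ε * (z 0).2 * deriv liftProfile (z 1).2, (z 1).2), z 2]

/-- A map of the plane, acting on the second factor. -/
def onSecond (φ : ℝ × ℝ → ℝ × ℝ) (z : PhaseSpace 3) : PhaseSpace 3 := ![z 0, φ (z 1), z 2]

theorem scalesFormAt_onSecond {φ : ℝ × ℝ → ℝ × ℝ} {z : PhaseSpace 3}
    (h : ScalesAreaAt 1 φ (z 1)) : ScalesFormAt 1 (onSecond φ) z := by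
  have e : onSecond φ = fun z i => (![id, φ, id] : Fin 3 → ℝ × ℝ → ℝ × ℝ) i (z i) := by
    funext z i
    fin_cases i <;> rfl
  rw [e]
  refine scalesFormAt_prod fun i => ?_
  fin_cases i
  exacts [scalesAreaAt_id _, h, scalesAreaAt_id _]

theorem scalesFormAt_shear (z : PhaseSpace 3) : ScalesFormAt 1 shear z := by
  have hp : ∀ i : Fin 3, HasFDerivAt (fun z : PhaseSpace 3 => z i)
      (ContinuousLinearMap.proj (R := ℝ) (φ := fun _ : Fin 3 => ℝ × ℝ) i) z := fun i => hasFDerivAt_apply i z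
  refine scalesFormAt_vec (by fun_prop) (by fun_prop) (by fun_prop) (hp 0)
    ((hp 1).fst.prodMk ((hp 1).snd.add (hp 2).snd))
    (((hp 2).fst.sub (hp 1).fst).prodMk (hp 2).snd) fun u v => ?_
  simp [planeForm, stdSymplecticForm, Fin.sum_univ_three]
  ring

/-- This is the time-one flow of the Hamiltonian ε y₁ g(y₂) with g = `liftProfile`, which explains
the correction of x₂. -/
theorem scalesFormAt_lift (ε : ℝ) (z : PhaseSpace 3) : ScalesFormAt 1 (lift ε) z := by
  have hp : ∀ i : Fin 3, HasFDerivAt (fun z : PhaseSpace 3 => z i)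
      (ContinuousLinearMap.proj (R := ℝ) (φ := fun _ : Fin 3 => ℝ × ℝ) i) z := fun i => hasFDerivAt_apply i z
  have hl := contDiff_liftProfile
  have hl' : ContDiff ℝ ∞ (deriv liftProfile) := (contDiff_infty_iff_deriv.1 hl).2
  have hd := ((hl.differentiable (by simp) (z 1).2).hasDerivAt).comp_hasFDerivAt z (hp 1).snd
  have hd' := ((hl'.differentiable (by simp) (z 1).2).hasDerivAt).comp_hasFDerivAt z (hp 1).snd
  refine scalesFormAt_vec ?_ ?_ (by fun_prop)
    (((hp 0).fst.add (hd.const_mul ε)).prodMk (hp 0).snd)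
    (((hp 1).fst.add (((hp 0).snd.const_mul ε).mul hd')).prodMk (hp 1).snd)
    (hp 2) fun u v => ?_
  · have : ContDiff ℝ ∞ fun z : PhaseSpace 3 => liftProfile (z 1).2 := hl.comp (by fun_prop)
    fun_prop
  · have : ContDiff ℝ ∞ fun z : PhaseSpace 3 => deriv liftProfile (z 1).2 := hl'.comp (by fun_prop)
    fun_prop
  · simp [planeForm, stdSymplecticForm, Fin.sum_univ_three]
    ring

/-- A product of rectangles of areas `ε / M`, `1 / (4 η)` and `∞`. -/
structure InBox (ε M η : ℝ) (z : PhaseSpace 3) : Prop where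
  x₁ : 0 < (z 0).1 ∧ (z 0).1 < ε
  y₁ : 0 < (z 0).2 ∧ (z 0).2 < 1 / M
  x₂ : 0 < (z 1).1 ∧ (z 1).1 < 1 / η
  y₂ : 0 < (z 1).2 ∧ (z 1).2 < 1 / 4
  x₃ : 0 < (z 2).1 ∧ (z 2).1 < 1 / 4

/-! ### The composite map on the box -/

/-- The embedding of a product of rectangles which makes the second factor small. -/
noncomputable def foldMap (ε : ℝ) {η : ℝ} (hη : 0 < η) : PhaseSpace 3 → PhaseSpace 3 :=
  onSecond (polar ∘ ribbon) ∘ lift ε ∘ onSecond (respeed hη) ∘ shear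

/-- The intermediate coordinate `y₂` of the embedding. -/
noncomputable def time {η : ℝ} (hη : 0 < η) (z : PhaseSpace 3) : ℝ :=
  (clockHomeo hη).symm ((z 1).2 + (z 2).2)

/-- The intermediate coordinate `x₂` of the embedding. -/
noncomputable def height (ε : ℝ) {η : ℝ} (hη : 0 < η) (z : PhaseSpace 3) : ℝ :=
  1 + (z 1).1 * (η + bulkBump (time hη z)) + ε * (z 0).2 * deriv liftProfile (time hη z)

theorem foldMap_zero (ε : ℝ) {η : ℝ} (hη : 0 < η) (z : PhaseSpace 3) :
    foldMap ε hη z 0 = ((z 0).1 + ε * liftProfile (time hη z), (z 0).2) := rfl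

theorem foldMap_one (ε : ℝ) {η : ℝ} (hη : 0 < η) (z : PhaseSpace 3) :
    foldMap ε hη z 1 = polar (ribbon (height ε hη z, time hη z)) := rfl

theorem foldMap_two (ε : ℝ) {η : ℝ} (hη : 0 < η) (z : PhaseSpace 3) :
    foldMap ε hη z 2 = ((z 2).1 - (z 1).1, (z 2).2) := rfl

section

variable {ε M η : ℝ}

/-- The displacement of x₂ is at most ε (1 / M) M ≤ 1/2, and off the arms the strip has width η x₂ <
1; hence 1 - 1/2 and 1 + 1 + 1/2. -/
theorem height_bounds (hε : 0 < ε) (hε' : ε ≤ 1 / 2) (hM : 1 ≤ M)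
    (hd : ∀ t, |deriv liftProfile t| ≤ M) (hη : 0 < η) {z : PhaseSpace 3} (hz : InBox ε M η z) :
    1 / 2 ≤ height ε hη z ∧ (cos (time hη z) < 19 / 20 → height ε hη z ≤ 5 / 2) := by
  have hshift : |ε * (z 0).2 * deriv liftProfile (time hη z)| ≤ 1 / 2 := by
    rw [abs_mul, abs_mul, abs_of_pos hε, abs_of_pos hz.y₁.1]
    have hy : (z 0).2 * M ≤ 1 := ((lt_div_iff₀ (by linarith)).1 hz.y₁.2).le
    have h1 : (z 0).2 * |deriv liftProfile (time hη z)| ≤ 1 :=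
      (mul_le_mul_of_nonneg_left (hd _) hz.y₁.1.le).trans hy
    rw [mul_assoc]
    nlinarith
  rw [abs_le] at hshift
  have hx := (lt_div_iff₀ hη).1 hz.x₂.2
  refine ⟨?_, fun hc => ?_⟩
  · have : 0 ≤ (z 1).1 * (η + bulkBump (time hη z)) :=
      mul_nonneg hz.x₂.1.le (add_nonneg hη.le (bulkBump_nonneg _))
    unfold height
    linarith
  · unfold height
    rw [bulkBump_eq_zero hc.le, add_zero]
    linarith

theorem abs_ribbon_snd_lt (hε : 0 < ε) (hε' : ε ≤ 1 / 2) (hM : 1 ≤ M)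
    (hd : ∀ t, |deriv liftProfile t| ≤ M) (hη : 0 < η) {z : PhaseSpace 3} (hz : InBox ε M η z) :
    |(ribbon (height ε hη z, time hη z)).2| < 6 := by
  obtain ⟨h, hb⟩ := height_bounds hε hε' hM hd hη hz
  have hπ := pi_lt_d2
  rcases lt_or_ge (cos (time hη z)) (19 / 20) with hc | hc
  · have := abs_ribbon_snd_le (p := (height ε hη z, time hη z)) (by simpa using by linarith)
    have := hb hc
    simp only at *
    linarith
  · obtain ⟨n, hn⟩ := ribbon_of_cos_ge (t := time hη z) (by linarith)
    have := abs_ribbon_snd_le (p := (1 / 2, time hη z)) (by norm_num)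
    rw [hn] at this ⊢
    simp only at *
    linarith

theorem scalesFormAt_foldMap (hε : 0 < ε) (hε' : ε ≤ 1 / 2) (hM : 1 ≤ M)
    (hd : ∀ t, |deriv liftProfile t| ≤ M) (hη : 0 < η) {z : PhaseSpace 3} (hz : InBox ε M η z) :
    ScalesFormAt 1 (foldMap ε hη) z := by
  have hh := (height_bounds hε hε' hM hd hη hz).1
  have hw := abs_ribbon_snd_lt hε hε' hM hd hη hz
  have hr := scalesAreaAt_ribbon (p := (height ε hη z, time hη z)) (by simpa using by linarith)
  have hpr := (scalesAreaAt_polar (by linarith [(abs_lt.1 hw).1])).comp hr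
  rw [one_mul] at hpr
  have h1 := (scalesFormAt_onSecond (scalesAreaAt_respeed hη (shear z 1))).comp
    (scalesFormAt_shear z)
  have h2 := ScalesFormAt.comp (scalesFormAt_lift ε ((onSecond (respeed hη) ∘ shear) z)) h1
  have h3 := ScalesFormAt.comp (g := onSecond (polar ∘ ribbon)) (scalesFormAt_onSecond hpr) h2
  simp only [one_mul] at h3
  exact h3

theorem injOn_foldMap (hε : 0 < ε) (hε' : ε ≤ 1 / 2) (hM : 1 ≤ M)
    (hd : ∀ t, |deriv liftProfile t| ≤ M) (hη : 0 < η) (hη' : η ≤ 1) :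
    Set.InjOn (foldMap ε hη) {z | InBox ε M η z} := by
  intro z hz z' hz' h
  have e0 := congrFun h 0
  have e1 := congrFun h 1
  have e2 := congrFun h 2
  rw [foldMap_zero, foldMap_zero, Prod.mk.injEq] at e0
  rw [foldMap_one, foldMap_one] at e1
  rw [foldMap_two, foldMap_two, Prod.mk.injEq] at e2
  obtain ⟨hx1, hy1⟩ := e0
  obtain ⟨hx3, hy3⟩ := e2
  obtain ⟨hh, hb⟩ := height_bounds hε hε' hM hd hη hz
  obtain ⟨hh', hb'⟩ := height_bounds hε hε' hM hd hη hz'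
  have bx1 := hz.x₁
  have bx1' := hz'.x₁
  rcases polar_ribbon_injective hh hh' hb hb' e1 with ⟨⟨n, hn⟩, m, hm⟩ | ⟨hl, hl'⟩ | ⟨hl, hl'⟩
  · have ck : clock η (time hη z) = (z 1).2 + (z 2).2 := clock_symm_apply hη _
    have ck' : clock η (time hη z') = (z' 1).2 + (z' 2).2 := clock_symm_apply hη _
    -- Equal y₃ and y₂ in (0, 1/4) fix the clock to within 1/4, less than a period.
    have ht : time hη z = time hη z' := by
      refine eq_of_abs_clock_sub_lt hη hn ?_
      rw [ck, ck', hy3, abs_lt]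
      constructor <;> linarith [hz.y₂.1, hz.y₂.2, hz'.y₂.1, hz'.y₂.2]
    have hy2 : (z 1).2 = (z' 1).2 := by
      rw [ht, ck'] at ck
      linarith
    have hx2 : (z 1).1 = (z' 1).1 := by
      simp only [height, ht, hy1] at hm
      have hB := bulkBump_nonneg (time hη z')
      have hB' := bulkBump_le_one (time hη z')
      -- Equal x₃ - x₂ fixes x₂ to within 1/4, and B ≤ 2, so the product cannot reach 8π.
      set B := η + bulkBump (time hη z') with hBdef
      have hmul : ((z 1).1 - (z' 1).1) * B = m * (8 * π) := by linarith
      have hlt : |(z 1).1 - (z' 1).1| < 1 / 4 := by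
        rw [abs_lt]
        constructor <;> linarith [hz.x₃.1, hz.x₃.2, hz'.x₃.1, hz'.x₃.2]
      have hm0 : m = 0 := by
        have hab := congrArg abs hmul
        rw [abs_mul, abs_mul, abs_of_pos (by positivity : 0 < 8 * π),
          abs_of_pos (by linarith : 0 < B)] at hab
        have hm1 : |(m : ℝ)| < 1 := by
          by_contra hcon
          nlinarith [pi_gt_three, abs_nonneg ((z 1).1 - (z' 1).1)]
        rw [← Int.cast_abs] at hm1
        exact Int.abs_lt_one_iff.1 (by exact_mod_cast hm1)
      rw [hm0, Int.cast_zero, zero_mul] at hmul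
      rcases mul_eq_zero.1 hmul with h0 | h0 <;> linarith
    rw [ht] at hx1
    funext i
    fin_cases i
    · exact Prod.ext (by simpa using hx1) hy1
    · exact Prod.ext hx2 hy2
    · refine Prod.ext ?_ hy3
      simp only [Fin.reduceFinMk]
      linarith
  -- Both x₁ lie in (0, ε), so a relative displacement by ε separates the sheets.
  · rw [hl, hl'] at hx1
    linarith
  · rw [hl, hl'] at hx1
    linarith

end

/-! ### Rescaling from and to polydisks -/

theorem isOpen_polydisk {n : ℕ} (R : Fin n → ℝ) : IsOpen (polydisk R) := by
  have : polydisk R = ⋂ i, {p | (p i).1 ^ 2 + (p i).2 ^ 2 < R i ^ 2} := by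
    ext p
    simp [polydisk]
  rw [this]
  exact isOpen_iInter_of_finite fun i => isOpen_lt (by fun_prop) continuous_const

/-- A product of three affine maps of the plane which multiply area by `c`. -/
def affineMap (a b r : Fin 3 → ℝ) (z : PhaseSpace 3) : PhaseSpace 3 :=
  fun i => (a i * ((z i).1 + r i), b i * ((z i).2 + r i))

theorem scalesFormAt_affineMap {a b r : Fin 3 → ℝ} {c : ℝ} (h : ∀ i, a i * b i = c)
    (z : PhaseSpace 3) : ScalesFormAt c (affineMap a b r) z :=
  scalesFormAt_prod (φ := fun i q => (a i * (q.1 + r i), b i * (q.2 + r i)))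
    fun i => h i ▸ scalesAreaAt_affine _ _ _ _

theorem affineMap_injective {a b r : Fin 3 → ℝ} (ha : ∀ i, a i ≠ 0) (hb : ∀ i, b i ≠ 0) :
    Function.Injective (affineMap a b r) := by
  intro z z' h
  funext i
  have hi := congrFun h i
  simp only [affineMap, Prod.mk.injEq, mul_right_inj' (ha i), mul_right_inj' (hb i),
    add_left_inj] at hi
  exact Prod.ext hi.1 hi.2

set_option maxHeartbeats 1000000 in
theorem proposition2 :
    ∃ C : ℝ, 0 < C ∧ ∀ R₁ R₂ R₃ lam : ℝ,
      0 < R₁ → R₁ ≤ R₂ → R₂ ≤ R₃ → 1 ≤ lam → lam ≤ R₂ / R₁ →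
        SymplecticallyEmbeds (polydisk ![R₁, R₂, R₃])
          (polydisk ![C * R₁, C * (R₂ / lam), C * (lam * R₃)]) := by
  obtain ⟨M, hM, hd⟩ := exists_abs_deriv_liftProfile_le
  refine ⟨96 * M, by positivity, fun R₁ R₂ R₃ lam hR₁ h12 h23 hlam hlam' => ?_⟩
  have hM0 : 0 < M := by linarith
  have hR₂ : 0 < R₂ := by linarith
  have hR₃ : 0 < R₃ := by linarith
  have hl0 : 0 < lam := by linarith
  have hlR : lam * R₁ ≤ R₂ := (le_div_iff₀ hR₁).1 hlam'
  -- The unit of length for the squeezed factor. The bound λ ≤ R₂ / R₁ gives σ ≥ 8 M R₁, which makes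
  -- ε ≤ 1/2.
  obtain ⟨σ, hσ⟩ : ∃ σ, σ = 8 * M * (R₂ / lam) := ⟨_, rfl⟩
  have hσ0 : 0 < σ := by rw [hσ]; positivity
  have hσ1 : 8 * M * R₁ ≤ σ := by
    rw [hσ]
    exact mul_le_mul_of_nonneg_left ((le_div_iff₀ hl0).2 (by linarith)) (by positivity)
  have hσ2 : 8 * R₂ ≤ σ * lam := by
    rw [hσ, mul_assoc, div_mul_cancel₀ _ hl0.ne']
    nlinarith
  -- In units of σ², the square around the first disk has area 4 R₁² / σ² = ε / M.
  obtain ⟨ε, hεdef⟩ : ∃ ε, ε = 4 * R₁ ^ 2 * M / σ ^ 2 := ⟨_, rfl⟩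
  obtain ⟨η, hηdef⟩ : ∃ η, η = 1 / (16 * lam ^ 2) := ⟨_, rfl⟩
  have hε : 0 < ε := by rw [hεdef]; positivity
  have hε' : ε ≤ 1 / 2 := by
    rw [hεdef, div_le_iff₀ (by positivity)]
    have : (8 * M * R₁) ^ 2 ≤ σ ^ 2 := pow_le_pow_left₀ (by positivity) hσ1 2
    nlinarith [mul_nonneg (mul_nonneg hM0.le (sub_nonneg.2 hM)) (sq_nonneg R₁)]
  have hη : 0 < η := by rw [hηdef]; positivity
  have hη' : η ≤ 1 := by
    rw [hηdef, div_le_one (by positivity)]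
    nlinarith
  -- `a` and `b` fit the squares around the disks into the box; `a'` and `b'` reshape the image. The
  -- area factors 1 / σ² and σ² cancel.
  obtain ⟨a, ha⟩ : ∃ a : Fin 3 → ℝ, a = ![2 * R₁ * M / σ ^ 2, 8 * R₂ / σ ^ 2, 1 / (8 * R₃)] :=
    ⟨_, rfl⟩
  obtain ⟨b, hb⟩ : ∃ b : Fin 3 → ℝ, b = ![1 / (2 * R₁ * M), 1 / (8 * R₂), 8 * R₃ / σ ^ 2] :=
    ⟨_, rfl⟩
  obtain ⟨a', ha'⟩ : ∃ a' : Fin 3 → ℝ, a' = ![σ ^ 2 / (2 * R₁ * M), σ, R₃ / lam] := ⟨_, rfl⟩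
  obtain ⟨b', hb'⟩ : ∃ b' : Fin 3 → ℝ, b' = ![2 * R₁ * M, σ, σ ^ 2 * lam / R₃] := ⟨_, rfl⟩
  have hab : ∀ i, a i * b i = 1 / σ ^ 2 := by
    intro i
    rw [ha, hb]
    fin_cases i <;> simp <;> field_simp
  have hab' : ∀ i, a' i * b' i = σ ^ 2 := by
    intro i
    rw [ha', hb']
    fin_cases i <;> simp <;> field_simp
  have hne : ∀ i, a i ≠ 0 ∧ b i ≠ 0 := fun i => by
    rw [← mul_ne_zero_iff, hab]
    positivity
  have hne' : ∀ i, a' i ≠ 0 ∧ b' i ≠ 0 := fun i => by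
    rw [← mul_ne_zero_iff, hab']
    positivity
  set D : PhaseSpace 3 → PhaseSpace 3 := affineMap a b ![R₁, R₂, R₃] with hD
  set E : PhaseSpace 3 → PhaseSpace 3 := affineMap a' b' 0 with hE
  have hdisk : ∀ {x y R : ℝ}, 0 < R → x ^ 2 + y ^ 2 < R ^ 2 →
      (0 < x + R ∧ x + R < 2 * R) ∧ (0 < y + R ∧ y + R < 2 * R) := by
    intro x y R hR h
    have hx := abs_lt.1 (abs_lt_of_sq_lt_sq (by nlinarith [sq_nonneg y] : x ^ 2 < R ^ 2) hR.le)
    have hy := abs_lt.1 (abs_lt_of_sq_lt_sq (by nlinarith [sq_nonneg x] : y ^ 2 < R ^ 2) hR.le)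
    refine ⟨⟨?_, ?_⟩, ?_, ?_⟩ <;> linarith
  have hbox : ∀ z ∈ polydisk ![R₁, R₂, R₃], InBox ε M η (D z) ∧
      (0 < (D z 2).2 ∧ (D z 2).2 < 16 * R₃ ^ 2 / σ ^ 2) := by
    intro z hz
    obtain ⟨⟨x1, x1'⟩, y1, y1'⟩ := hdisk hR₁ (hz 0)
    obtain ⟨⟨x2, x2'⟩, y2, y2'⟩ := hdisk hR₂ (hz 1)
    obtain ⟨⟨x3, x3'⟩, y3, y3'⟩ := hdisk hR₃ (hz 2)
    refine ⟨⟨?_, ?_, ?_, ?_, ?_⟩, ?_⟩ <;> simp only [hD, affineMap, ha, hb] <;>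
      refine ⟨by simp; positivity, ?_⟩
    · calc 2 * R₁ * M / σ ^ 2 * ((z 0).1 + R₁) < 2 * R₁ * M / σ ^ 2 * (2 * R₁) := by gcongr
        _ = ε := by rw [hεdef]; ring
    · calc 1 / (2 * R₁ * M) * ((z 0).2 + R₁) < 1 / (2 * R₁ * M) * (2 * R₁) := by gcongr
        _ = 1 / M := by field_simp
    · have hσ3 : (8 * R₂) ^ 2 ≤ (σ * lam) ^ 2 := pow_le_pow_left₀ (by positivity) hσ2 2
      calc 8 * R₂ / σ ^ 2 * ((z 1).1 + R₂) < 8 * R₂ / σ ^ 2 * (2 * R₂) := by gcongr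
        _ = 16 * R₂ ^ 2 / σ ^ 2 := by ring
        _ ≤ 16 * lam ^ 2 := by
          rw [div_le_iff₀ (by positivity)]
          nlinarith [sq_nonneg R₂]
        _ = 1 / η := by rw [hηdef]; field_simp
    · calc 1 / (8 * R₂) * ((z 1).2 + R₂) < 1 / (8 * R₂) * (2 * R₂) := by gcongr
        _ = 1 / 4 := by field_simp; norm_num
    · calc 1 / (8 * R₃) * ((z 2).1 + R₃) < 1 / (8 * R₃) * (2 * R₃) := by gcongr
        _ = 1 / 4 := by field_simp; norm_num
    · calc 8 * R₃ / σ ^ 2 * ((z 2).2 + R₃) < 8 * R₃ / σ ^ 2 * (2 * R₃) := by gcongr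
        _ = 16 * R₃ ^ 2 / σ ^ 2 := by ring
  refine ⟨E ∘ foldMap ε hη ∘ D, isSymplecticEmbeddingOn_of_injOn (isOpen_polydisk _) ?_ ?_ ?_⟩
  · intro z hz
    have h1 : ScalesFormAt (1 / σ ^ 2) D z := scalesFormAt_affineMap hab z
    have h2 := (scalesFormAt_foldMap hε hε' hM hd hη (hbox z hz).1).comp h1
    have h3 : ScalesFormAt (σ ^ 2) E ((foldMap ε hη ∘ D) z) := scalesFormAt_affineMap hab' _
    have h4 := h3.comp h2
    have e : σ ^ 2 * (1 * (1 / σ ^ 2)) = 1 := by field_simp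
    rw [e] at h4
    exact h4
  · intro z hz z' hz' h
    have h1 := affineMap_injective (fun i => (hne' i).1) (fun i => (hne' i).2) h
    have h2 := injOn_foldMap hε hε' hM hd hη hη' (hbox z hz).1 (hbox z' hz').1 h1
    exact affineMap_injective (fun i => (hne i).1) (fun i => (hne i).2) h2
  · intro z hz
    obtain ⟨hB, hy3, hy3'⟩ := hbox z hz
    set w := D z
    intro i
    fin_cases i
    · show (a' 0 * ((foldMap ε hη w 0).1 + 0)) ^ 2 + (b' 0 * ((foldMap ε hη w 0).2 + 0)) ^ 2 <
        (96 * M * R₁) ^ 2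
      rw [foldMap_zero, ha', hb', add_zero, add_zero]
      simp only [Matrix.cons_val_zero]
      have hl := liftProfile_nonneg (time hη w)
      have hl' := liftProfile_le_one (time hη w)
      have h1 : 0 ≤ (w 0).1 + ε * liftProfile (time hη w) :=
        add_nonneg hB.x₁.1.le (mul_nonneg hε.le hl)
      have h1' : (w 0).1 + ε * liftProfile (time hη w) ≤ 2 * ε := by nlinarith [hB.x₁.2]
      have h2 : σ ^ 2 / (2 * R₁ * M) * ((w 0).1 + ε * liftProfile (time hη w)) ≤ 4 * R₁ := by
        calc _ ≤ σ ^ 2 / (2 * R₁ * M) * (2 * ε) := by gcongr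
          _ = 4 * R₁ := by rw [hεdef]; field_simp
      have h3 : 2 * R₁ * M * (w 0).2 ≤ 2 * R₁ := by
        calc _ ≤ 2 * R₁ * M * (1 / M) := by gcongr; exact hB.y₁.2.le
          _ = 2 * R₁ := by field_simp
      have h2' := pow_le_pow_left₀ (mul_nonneg (by positivity) h1) h2 2
      have h3' := pow_le_pow_left₀ (mul_nonneg (by positivity) hB.y₁.1.le) h3 2
      have h4 : (96 * R₁) ^ 2 ≤ (96 * M * R₁) ^ 2 :=
        pow_le_pow_left₀ (by positivity) (by nlinarith) 2
      refine (add_le_add h2' h3').trans_lt (lt_of_lt_of_le ?_ h4)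
      linarith [pow_pos hR₁ 2]
    · show (a' 1 * ((foldMap ε hη w 1).1 + 0)) ^ 2 + (b' 1 * ((foldMap ε hη w 1).2 + 0)) ^ 2 <
        (96 * M * (R₂ / lam)) ^ 2
      have hw := abs_lt.1 (abs_ribbon_snd_lt hε hε' hM hd hη hB)
      have hn := polar_normSq (w := ribbon (height ε hη w, time hη w)) (by linarith)
      rw [foldMap_one, ha', hb', add_zero, add_zero]
      simp only [Matrix.cons_val_one, Matrix.cons_val_zero]
      -- The squared radius is below 8 (6 + 10) = 128 < 12², and 96 = 12 · 8.
      have e : 96 * M * (R₂ / lam) = 12 * σ := by rw [hσ]; ring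
      rw [e, mul_pow, mul_pow, ← mul_add, hn]
      nlinarith [sq_pos_of_pos hσ0]
    · show (a' 2 * ((foldMap ε hη w 2).1 + 0)) ^ 2 + (b' 2 * ((foldMap ε hη w 2).2 + 0)) ^ 2 <
        (96 * M * (lam * R₃)) ^ 2
      rw [foldMap_two, ha', hb', add_zero, add_zero]
      simp only [Matrix.cons_val]
      have hx2 := hB.x₂
      rw [hηdef, one_div_one_div] at hx2
      have hx : |(w 2).1 - (w 1).1| ≤ 17 * lam ^ 2 := by
        rw [abs_le]
        constructor <;> nlinarith [hx2.1, hx2.2, hB.x₃.1, hB.x₃.2]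
      have h1 : |R₃ / lam * ((w 2).1 - (w 1).1)| ≤ 17 * (lam * R₃) := by
        rw [abs_mul, abs_of_pos (by positivity)]
        calc _ ≤ R₃ / lam * (17 * lam ^ 2) := by gcongr
          _ = 17 * (lam * R₃) := by field_simp
      have h2 : σ ^ 2 * lam / R₃ * (w 2).2 ≤ 16 * (lam * R₃) := by
        calc _ ≤ σ ^ 2 * lam / R₃ * (16 * R₃ ^ 2 / σ ^ 2) := by gcongr
          _ = 16 * (lam * R₃) := by field_simp
      have h1' := pow_le_pow_left₀ (abs_nonneg _) h1 2
      rw [sq_abs] at h1'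
      have h2' := pow_le_pow_left₀ (by positivity) h2 2
      have h4 : (96 * (lam * R₃)) ^ 2 ≤ (96 * M * (lam * R₃)) ^ 2 := by
        refine pow_le_pow_left₀ (by positivity) ?_ 2
        gcongr
        linarith
      refine (add_le_add h1' h2').trans_lt (lt_of_lt_of_le ?_ h4)
      linarith [pow_pos (mul_pos hl0 hR₃) 2]
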